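/- Let $n\ge 1$. For a measurable function $f$ on $\mathbb R^n$ let $$M_{\mathrm S}f(x)=\sup_{R\ni x}\frac1{|R|}\int_R|f|$$ be the strong maximal function, where the supremum is over all nonempty bounded open rectangular parallelepipeds $R\subset\mathbb R^n$ containing $x$ with sides parallel to the coordinate axes, and $|\cdot|$ is Lebesgue measure. Let $\phi_{\mathrm S}$ be the halo function of $M_{\mathrm S}$: $$\phi_{\mathrm S}(\alpha)=\sup_{E}\frac{1}{|E|}\left|\left\{x\in\mathbb R^n: M_{\mathrm S}\chi_E(x)>\tfrac1\alpha\right\}\right|\quad\text{for }\alpha>1,$$ where the supremum is over all measurable $E\subset\mathbb R^n$ with $0<|E|<\infty$, and $\phi_{\mathrm S}(\alpha)=\alpha$ for $0\le\alpha\le1$. Then $\phi_{\mathrm S}$ is finite on $[0,\infty)$ and $\phi_{\mathrm S}\in C^{1/n}([0,\infty))$; that is, for every compact set $K\subset[0,\infty)$ there is a constant $C_{n,K}<\infty$ such that $$|\phi_{\mathrm S}(x)-\phi_{\mathrm S}(y)|\le C_{n,K}\,|x-y|^{1/n}\qquad\text{for all }x,y\in K.$$ -/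

import Mathlib

open MeasureTheory Set
open scoped ENNReal NNReal

noncomputable section

/-- The maximal operator `M_B f (x) = sup_{x ∈ R ∈ B} |R|⁻¹ ∫_R |f|` associated with a collection
`B` of subsets of `ℝⁿ`, with values in `[0, ∞]`; it is `0` at points covered by no member of `B`. -/
def maximalOperator {n : ℕ} (B : Set (Set (Fin n → ℝ))) (f : (Fin n → ℝ) → ℝ)
    (x : Fin n → ℝ) : ℝ≥0∞ :=
  ⨆ R ∈ {R ∈ B | x ∈ R}, (∫⁻ y in R, ‖f y‖ₑ) / volume R

/-- The halo set `{x : M_B χ_E (x) > t}`. -/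
def haloSet {n : ℕ} (B : Set (Set (Fin n → ℝ))) (t : ℝ) (E : Set (Fin n → ℝ)) :
    Set (Fin n → ℝ) :=
  {x | ENNReal.ofReal t < maximalOperator B (E.indicator fun _ => (1 : ℝ)) x}

/-- The halo function of `B`, with values in `[0, ∞]`: for `α > 1` it is the supremum of
`|{x : M_B χ_E (x) > 1 / α}| / |E|` over all measurable `E` with `0 < |E| < ∞`, and it is `α`
for `α ∈ [0, 1]`. (Arguments `α < 0` are irrelevant.) -/
def haloFunction {n : ℕ} (B : Set (Set (Fin n → ℝ))) (α : ℝ) : ℝ≥0∞ :=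
  if 1 < α then
    ⨆ E ∈ {E : Set (Fin n → ℝ) | MeasurableSet E ∧ 0 < volume E ∧ volume E < ∞},
      volume (haloSet B (1 / α) E) / volume E
  else ENNReal.ofReal α

/-- All (bounded, open, nonempty) rectangular parallelepipeds in `ℝⁿ` with sides parallel to the
coordinate axes: the basis of the strong maximal operator. -/
def strongBasis (n : ℕ) : Set (Set (Fin n → ℝ)) :=
  {R | ∃ a b : Fin n → ℝ, (∀ i, a i < b i) ∧ R = Set.univ.pi fun i => Set.Ioo (a i) (b i)}

/-- The Hölder class `C^p(I)`: on every compact `K ⊆ I` one has `|f x - f y| ≤ C_K |x - y| ^ p`. -/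
def LocallyHolderOn (p : ℝ≥0) (f : ℝ → ℝ) (I : Set ℝ) : Prop :=
  ∀ K ⊆ I, IsCompact K → ∃ C : ℝ≥0, HolderOnWith C p f K

end

/-! Two facts combine: a Solyanik estimate and a growth estimate.

Solyanik estimate: adjoining to E every box R with |R \ E| < η|R| gives a set of measure at most (1
+ O(η^(1/n)))|E| for small η. In dimension one an overlap-two subfamily of intervals gives the
factor (1 + ε)/(1 - ε). Markov's inequality on sections makes thresholds and factors multiply under
products (`HaloBound.prod`), so threshold ε^n goes with the n-th power of that factor. This is the
origin of the exponent 1/n.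

Growth estimate: let E' be the level halo of E at threshold 2δ. If |R \ E| ≥ δ|R|, then |R ∩ E'| ≥
(1 + δ/5^n)|R ∩ E| (`measure_inter_le_measure_levelHalo_sdiff`); otherwise R ⊆ E'. So for α > 1 and
β = α(1 + δ/5^n), every box in which E has density above 1/β is one in which E' has density above
1/α. Hence φ(β) ≤ φ(α) sup |E'|/|E| ≤ φ(α)(1 + O(δ^(1/n))) for small δ. As δ is comparable to β - α
for bounded α, this and monotonicity give the local Hölder bound. -/

/-- The set `E` together with all members `B i` of the family `B` in which the complement of `E` has
relative measure less than `e`. -/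
def levelHalo {X ι : Type*} [MeasurableSpace X] (μ : Measure X) (B : ι → Set X) (e : ℝ≥0∞)
    (E : Set X) : Set X :=
  E ∪ ⋃ i, ⋃ (_ : μ (B i \ E) < e * μ (B i)), B i

/-- The set `levelHalo μ B e E` has at most `C` times the measure of `E`, for all measurable `E`. -/
def HaloBound {X ι : Type*} [MeasurableSpace X] (μ : Measure X) (B : ι → Set X) (e C : ℝ≥0∞) :
    Prop :=
  ∀ E, MeasurableSet E → μ (levelHalo μ B e E) ≤ C * μ E

/-! ### Level halos and products -/

section LevelHalo

variable {X Y ι κ : Type*} [MeasurableSpace X] [MeasurableSpace Y] {μ : Measure X} {ν : Measure Y}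
  {B : ι → Set X} {B' : κ → Set Y} {e e' C C' : ℝ≥0∞} {E : Set X}

lemma subset_levelHalo : E ⊆ levelHalo μ B e E := subset_union_left

lemma subset_levelHalo_of_lt {i : ι} (h : μ (B i \ E) < e * μ (B i)) :
    B i ⊆ levelHalo μ B e E :=
  (subset_iUnion₂ (s := fun i (_ : μ (B i \ E) < e * μ (B i)) => B i) i h).trans
    subset_union_right

lemma mem_levelHalo {x : X} :
    x ∈ levelHalo μ B e E ↔ x ∈ E ∨ ∃ i, μ (B i \ E) < e * μ (B i) ∧ x ∈ B i := by
  simp [levelHalo]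

/-- Taking level halos of the sections of a measurable set in a product yields a measurable set. -/
lemma measurableSet_levelHalo_section [Countable κ] [SFinite ν] (hB' : ∀ j, MeasurableSet (B' j))
    {F : Set (X × Y)} (hF : MeasurableSet F) :
    MeasurableSet {p : X × Y | p.2 ∈ levelHalo ν B' e' (Prod.mk p.1 ⁻¹' F)} := by
  have : {p : X × Y | p.2 ∈ levelHalo ν B' e' (Prod.mk p.1 ⁻¹' F)} =
      F ∪ ⋃ j, {x | ν (B' j \ Prod.mk x ⁻¹' F) < e' * ν (B' j)} ×ˢ B' j := by
    ext ⟨x, y⟩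
    simp [mem_levelHalo]
  rw [this]
  refine hF.union (.iUnion fun j => .prod ?_ (hB' j))
  refine measurableSet_lt ?_ measurable_const
  have := measurable_measure_prodMk_left (ν := ν) ((MeasurableSet.univ.prod (hB' j)).diff hF)
  convert this using 3 with x
  ext y
  simp

lemma measure_levelHalo_section_le [Countable κ] [SFinite ν] (hB' : ∀ j, MeasurableSet (B' j))
    (h : HaloBound ν B' e' C') {F : Set (X × Y)} (hF : MeasurableSet F) :
    μ.prod ν {p : X × Y | p.2 ∈ levelHalo ν B' e' (Prod.mk p.1 ⁻¹' F)} ≤ C' * μ.prod ν F := by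
  rw [Measure.prod_apply (measurableSet_levelHalo_section hB' hF), Measure.prod_apply hF,
    ← lintegral_const_mul _ (measurable_measure_prodMk_left hF)]
  exact lintegral_mono fun x => h _ (measurable_prodMk_left hF)

/-- Fill E along the Y-sections, then fill the result along the X-sections. If R × S misses less
than the proportion e * e' of its measure, then by Markov the points of R whose section misses at
least the proportion e' of S form less than the proportion e of R. All other points x have {x} × S
filled at the first stage, so the second stage fills R × {y} for every y in S. Countability makes
the filled sets measurable, as Tonelli requires. -/
lemma HaloBound.prod [Countable ι] [Countable κ] [SFinite μ] [SFinite ν]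
    (hB : ∀ i, MeasurableSet (B i)) (hB' : ∀ j, MeasurableSet (B' j))
    (h : HaloBound μ B e C) (h' : HaloBound ν B' e' C') :
    HaloBound (μ.prod ν) (fun p : ι × κ => B p.1 ×ˢ B' p.2) (e * e') (C * C') := by
  intro E hE
  set E₁ : Set (X × Y) := {p | p.2 ∈ levelHalo ν B' e' (Prod.mk p.1 ⁻¹' E)} with hE₁
  have hE₁m : MeasurableSet E₁ := measurableSet_levelHalo_section hB' hE
  set F : Set (Y × X) := Prod.swap ⁻¹' E₁ with hF
  have hFm : MeasurableSet F := measurable_swap hE₁m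
  set F₁ : Set (Y × X) := {p | p.2 ∈ levelHalo μ B e (Prod.mk p.1 ⁻¹' F)} with hF₁
  have hF₁m : MeasurableSet F₁ := measurableSet_levelHalo_section hB hFm
  have hsub : levelHalo (μ.prod ν) (fun p : ι × κ => B p.1 ×ˢ B' p.2) (e * e') E ⊆
      Prod.swap ⁻¹' F₁ := by
    rintro ⟨x, y⟩ hxy
    rcases mem_levelHalo.1 hxy with hxy | ⟨⟨i, j⟩, hlt, hx, hy⟩
    · exact subset_levelHalo (subset_levelHalo hxy)
    have hx : x ∈ B i := hx
    have hy : y ∈ B' j := hy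
    refine subset_levelHalo_of_lt (i := i) ?_ hx
    -- The exceptional points, whose sections are not filled at the first stage.
    set G : Set X := {x | e' * ν (B' j) ≤ ν (B' j \ Prod.mk x ⁻¹' E)} with hG
    have h1 : B i \ Prod.mk y ⁻¹' F ⊆ G ∩ B i := by
      rintro z ⟨hz, hzF⟩
      refine ⟨?_, hz⟩
      by_contra hcon
      exact hzF (subset_levelHalo_of_lt (i := j) (not_le.1 hcon) hy)
    have hmeas : Measurable fun x => ν (Prod.mk x ⁻¹' ((B i ×ˢ B' j) \ E)) :=
      measurable_measure_prodMk_left (((hB i).prod (hB' j)).diff hE)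
    have h2 : e' * ν (B' j) * μ (B i \ Prod.mk y ⁻¹' F) ≤ μ.prod ν ((B i ×ˢ B' j) \ E) := by
      rw [Measure.prod_apply (((hB i).prod (hB' j)).diff hE)]
      refine le_trans ?_ (mul_meas_ge_le_lintegral hmeas (e' * ν (B' j)))
      gcongr
      intro z hz
      obtain ⟨hzG, hzB⟩ := h1 hz
      refine le_trans hzG (measure_mono ?_)
      exact fun w hw => And.intro (And.intro hzB hw.1) hw.2
    have h3 := h2.trans_lt hlt
    simp only [Measure.prod_prod] at h3
    by_contra hcon
    refine absurd h3 (not_lt.2 ?_)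
    calc e * e' * (μ (B i) * ν (B' j)) = e' * ν (B' j) * (e * μ (B i)) := by ring
      _ ≤ _ := by gcongr; exact not_lt.1 hcon
  calc μ.prod ν (levelHalo (μ.prod ν) (fun p : ι × κ => B p.1 ×ˢ B' p.2) (e * e') E)
      ≤ μ.prod ν (Prod.swap ⁻¹' F₁) := measure_mono hsub
    _ = ν.prod μ F₁ := Measure.measurePreserving_swap.measure_preimage hF₁m.nullMeasurableSet
    _ ≤ C * ν.prod μ F := measure_levelHalo_section_le hB h hFm
    _ = C * μ.prod ν E₁ := by
      rw [Measure.measurePreserving_swap.measure_preimage hE₁m.nullMeasurableSet]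
    _ ≤ C * (C' * μ.prod ν E) := by
      gcongr; exact measure_levelHalo_section_le hB' h' hE
    _ = C * C' * μ.prod ν E := by ring

lemma HaloBound.of_measurePreserving (f : X ≃ᵐ Y) (hf : MeasurePreserving f μ ν)
    (hB : ∀ i, ∃ j, B i = f ⁻¹' B' j) (h : HaloBound ν B' e C) : HaloBound μ B e C := by
  intro E hE
  have key : ∀ S : Set Y, μ (f ⁻¹' S) = ν S := fun S =>
    hf.measure_preimage_equiv S
  have hE' : E = f ⁻¹' (f.symm ⁻¹' E) := by ext; simp
  have hsub : levelHalo μ B e E ⊆ f ⁻¹' levelHalo ν B' e (f.symm ⁻¹' E) := by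
    intro x hx
    rcases mem_levelHalo.1 hx with hx | ⟨i, hi, hx⟩
    · exact subset_levelHalo (by simpa using hx)
    obtain ⟨j, hj⟩ := hB i
    rw [hj] at hx hi
    rw [hE', ← preimage_sdiff, key, key] at hi
    exact subset_levelHalo_of_lt hi hx
  calc μ (levelHalo μ B e E) ≤ ν (levelHalo ν B' e (f.symm ⁻¹' E)) :=
        (measure_mono hsub).trans (key _).le
    _ ≤ C * ν (f.symm ⁻¹' E) := h _ (f.symm.measurable hE)
    _ = C * μ E := by rw [← key, ← hE']

end LevelHalo

/-! ### The one-dimensional estimate -/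

/-- A finite family of open intervals has a subfamily with the same union and with multiplicity at
most two. -/
lemma exists_subset_biUnion_Ioo_card_le_two {ι : Type*} (a b : ι → ℝ) (s : Finset ι) :
    ∃ t ⊆ s, (⋃ i ∈ s, Ioo (a i) (b i)) ⊆ (⋃ i ∈ t, Ioo (a i) (b i)) ∧
      ∀ x, ∀ u ⊆ t, (∀ i ∈ u, x ∈ Ioo (a i) (b i)) → u.card ≤ 2 := by
  classical
  induction s using Finset.strongInduction with
  | H s ih =>
    by_cases hs : ∀ x, ∀ u ⊆ s, (∀ i ∈ u, x ∈ Ioo (a i) (b i)) → u.card ≤ 2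
    · exact ⟨s, subset_rfl, subset_rfl, hs⟩
    push Not at hs
    obtain ⟨x, u, hus, hu, hcard⟩ := hs
    have hne : u.Nonempty := Finset.card_pos.1 (by omega)
    obtain ⟨l, hl, hlmin⟩ := u.exists_min_image a hne
    obtain ⟨r, hr, hrmax⟩ := u.exists_max_image b hne
    -- Among three intervals through `x`, those reaching furthest left and furthest right cover any
    -- other, so `c` can be discarded.
    obtain ⟨c, hc, hcn⟩ : ∃ c ∈ u, c ∉ ({l, r} : Finset ι) :=
      Finset.exists_mem_notMem_of_card_lt_card (Finset.card_le_two.trans_lt hcard)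
    simp only [Finset.mem_insert, Finset.mem_singleton, not_or] at hcn
    obtain ⟨t, hts, htU, ht⟩ := ih (s.erase c) (Finset.erase_ssubset (hus hc))
    refine ⟨t, hts.trans (Finset.erase_subset _ _), subset_trans ?_ htU, ht⟩
    intro y hy
    simp only [mem_iUnion, exists_prop] at hy ⊢
    obtain ⟨i, hi, hy⟩ := hy
    by_cases hic : i = c
    · subst hic
      rcases le_total y x with hyx | hyx
      · exact ⟨l, Finset.mem_erase.2 ⟨fun h => hcn.1 h.symm, hus hl⟩,
          (hlmin i hc).trans_lt hy.1, hyx.trans_lt (hu l hl).2⟩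
      · exact ⟨r, Finset.mem_erase.2 ⟨fun h => hcn.2 h.symm, hus hr⟩,
          (hu r hr).1.trans_le hyx, hy.2.trans_le (hrmax i hc)⟩
    · exact ⟨i, Finset.mem_erase.2 ⟨hic, hi⟩, hy⟩

lemma sum_measure_inter_le_of_card_le {X ι : Type*} [MeasurableSpace X] {μ : Measure X}
    {B : ι → Set X} (hB : ∀ i, MeasurableSet (B i)) (t : Finset ι) (N : ℕ)
    (ht : ∀ x, ∀ u ⊆ t, (∀ i ∈ u, x ∈ B i) → u.card ≤ N) (E : Set X) :
    ∑ i ∈ t, μ (E ∩ B i) ≤ N * μ E := by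
  classical
  calc ∑ i ∈ t, μ (E ∩ B i) = ∑ i ∈ t, ∫⁻ x in E, (B i).indicator 1 x ∂μ := by
        refine Finset.sum_congr rfl fun i _ => ?_
        rw [lintegral_indicator_one (hB i), Measure.restrict_apply (hB i), inter_comm]
    _ = ∫⁻ x in E, ∑ i ∈ t, (B i).indicator 1 x ∂μ :=
        (lintegral_finsetSum _ fun i _ => measurable_one.indicator (hB i)).symm
    _ ≤ ∫⁻ _ in E, N ∂μ := by
        refine lintegral_mono fun x => ?_
        have h := ht x (t.filter fun i => x ∈ B i) (Finset.filter_subset _ _) (by simp)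
        simp only [Set.indicator_apply, Pi.one_apply, Finset.sum_ite, Finset.sum_const,
          nsmul_eq_mul, mul_one, mul_zero, add_zero]
        exact_mod_cast h
    _ = N * μ E := by simp

/-- Only the part added outside E is estimated, so the factor tends to 1 with ε. An admissible
interval satisfies |I \ E| ≤ ε/(1 - ε) |I ∩ E|; summing over a subfamily of multiplicity two bounds
the added part by 2ε/(1 - ε) |E|. -/
lemma haloBound_Ioo {ε : ℝ} (h0 : 0 < ε) (h1 : ε < 1) :
    HaloBound volume (fun p : ℚ × ℚ => Ioo (p.1 : ℝ) p.2) (ENNReal.ofReal ε)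
      (ENNReal.ofReal ((1 + ε) / (1 - ε))) := by
  classical
  intro E hE
  set I : ℚ × ℚ → Set ℝ := fun p => Ioo (p.1 : ℝ) p.2 with hI
  have hIm : ∀ p, MeasurableSet (I p) := fun p => measurableSet_Ioo
  have hIfin : ∀ p, volume (I p) ≠ ∞ := fun p => by simp [I]
  have hc0 : 0 ≤ ε / (1 - ε) := div_nonneg h0.le (by linarith)
  have hone : ∀ p, volume (I p \ E) < ENNReal.ofReal ε * volume (I p) →
      volume (I p \ E) ≤ ENNReal.ofReal (ε / (1 - ε)) * volume (E ∩ I p) := by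
    intro p hp
    rw [← measure_inter_add_sdiff (I p) hE] at hp
    have f1 : volume (I p \ E) ≠ ∞ := measure_ne_top_of_subset sdiff_subset (hIfin p)
    have f2 : volume (I p ∩ E) ≠ ∞ := measure_ne_top_of_subset inter_subset_left (hIfin p)
    rw [inter_comm E]
    lift volume (I p \ E) to ℝ≥0 using f1 with y
    lift volume (I p ∩ E) to ℝ≥0 using f2 with z
    rw [← ENNReal.ofReal_coe_nnreal, ← ENNReal.ofReal_coe_nnreal,
      ← ENNReal.ofReal_add (by positivity) (by positivity), ← ENNReal.ofReal_mul h0.le,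
      ENNReal.ofReal_lt_ofReal_iff_of_nonneg (by positivity)] at hp
    rw [← ENNReal.ofReal_coe_nnreal, ← ENNReal.ofReal_coe_nnreal, ← ENNReal.ofReal_mul hc0]
    refine ENNReal.ofReal_le_ofReal ?_
    rw [div_mul_eq_mul_div, le_div_iff₀ (by linarith)]
    linarith
  have hfinite : ∀ s : Finset (ℚ × ℚ),
      (∀ p ∈ s, volume (I p \ E) < ENNReal.ofReal ε * volume (I p)) →
      volume ((⋃ p ∈ s, I p) \ E) ≤ ENNReal.ofReal (2 * (ε / (1 - ε))) * volume E := by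
    intro s hs
    obtain ⟨t, hts, hst, ht⟩ := exists_subset_biUnion_Ioo_card_le_two
      (fun p : ℚ × ℚ => (p.1 : ℝ)) (fun p => (p.2 : ℝ)) s
    calc volume ((⋃ p ∈ s, I p) \ E) ≤ volume (⋃ p ∈ t, I p \ E) := by
          refine measure_mono ?_
          rintro x ⟨hx, hxE⟩
          obtain ⟨p, hp, hxp⟩ := mem_iUnion₂.1 (hst hx)
          exact mem_iUnion₂.2 ⟨p, hp, hxp, hxE⟩
      _ ≤ ∑ p ∈ t, volume (I p \ E) := measure_biUnion_finset_le _ _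
      _ ≤ ∑ p ∈ t, ENNReal.ofReal (ε / (1 - ε)) * volume (E ∩ I p) :=
          Finset.sum_le_sum fun p hp => hone p (hs p (hts hp))
      _ = ENNReal.ofReal (ε / (1 - ε)) * ∑ p ∈ t, volume (E ∩ I p) := by rw [Finset.mul_sum]
      _ ≤ ENNReal.ofReal (ε / (1 - ε)) * ((2 : ℕ) * volume E) := by
          gcongr
          exact sum_measure_inter_le_of_card_le hIm t 2 ht E
      _ = ENNReal.ofReal (2 * (ε / (1 - ε))) * volume E := by
          rw [ENNReal.ofReal_mul (by norm_num)]
          simp only [Nat.cast_ofNat, ENNReal.ofReal_ofNat]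
          ring
  set S : Set (ℚ × ℚ) := {p | volume (I p \ E) < ENNReal.ofReal ε * volume (I p)} with hS
  have hU : volume ((⋃ p ∈ S, I p) \ E) ≤ ENNReal.ofReal (2 * (ε / (1 - ε))) * volume E := by
    -- The bound for finite subfamilies passes to their directed union by continuity from below.
    have : (⋃ p ∈ S, I p) \ E = ⋃ s : {s : Finset (ℚ × ℚ) // ∀ p ∈ s, p ∈ S},
        (⋃ p ∈ s.1, I p) \ E := by
      ext x
      simp only [mem_sdiff, mem_iUnion, exists_prop, Subtype.exists]
      constructor
      · rintro ⟨⟨p, hp, hx⟩, hxE⟩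
        exact ⟨{p}, by simpa using hp, ⟨p, by simp, hx⟩, hxE⟩
      · rintro ⟨s, hs, ⟨p, hp, hx⟩, hxE⟩
        exact ⟨⟨p, hs p hp, hx⟩, hxE⟩
    rw [this, Directed.measure_iUnion]
    · exact iSup_le fun s => hfinite s.1 s.2
    · intro s t
      refine ⟨⟨s.1 ∪ t.1, fun p hp => ?_⟩, ?_, ?_⟩
      · rcases Finset.mem_union.1 hp with hp | hp
        exacts [s.2 p hp, t.2 p hp]
      · exact sdiff_subset_sdiff_left (biUnion_subset_biUnion_left fun p hp =>
          Finset.mem_union_left _ hp)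
      · exact sdiff_subset_sdiff_left (biUnion_subset_biUnion_left fun p hp =>
          Finset.mem_union_right _ hp)
  have heq : levelHalo volume I (ENNReal.ofReal ε) E = E ∪ ((⋃ p ∈ S, I p) \ E) := by
    rw [union_sdiff_self]; rfl
  rw [heq]
  calc volume (E ∪ ((⋃ p ∈ S, I p) \ E))
      ≤ volume E + ENNReal.ofReal (2 * (ε / (1 - ε))) * volume E :=
        (measure_union_le _ _).trans (by gcongr)
    _ = ENNReal.ofReal ((1 + ε) / (1 - ε)) * volume E := by
        have : (1 + ε) / (1 - ε) = 1 + 2 * (ε / (1 - ε)) := by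
          field_simp [show (1 - ε) ≠ 0 by linarith]; ring
        rw [this, ENNReal.ofReal_add zero_le_one (by positivity), ENNReal.ofReal_one, add_mul,
          one_mul]

/-! ### Boxes and the Solyanik estimate in dimension n -/

/-- The open rectangular parallelepiped with opposite vertices `p.1` and `p.2`. -/
def openBox {n : ℕ} (p : (Fin n → ℝ) × (Fin n → ℝ)) : Set (Fin n → ℝ) :=
  Set.univ.pi fun i => Ioo (p.1 i) (p.2 i)

/-- The open rectangular parallelepiped with opposite vertices `p.1` and `p.2`, both rational. -/
def ratBox {n : ℕ} (p : (Fin n → ℚ) × (Fin n → ℚ)) : Set (Fin n → ℝ) :=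
  openBox (fun i => (p.1 i : ℝ), fun i => (p.2 i : ℝ))

section OpenBox

variable {n : ℕ}

lemma mem_openBox {p : (Fin n → ℝ) × (Fin n → ℝ)} {x : Fin n → ℝ} :
    x ∈ openBox p ↔ ∀ i, p.1 i < x i ∧ x i < p.2 i := by
  simp [openBox]

lemma isOpen_openBox (p : (Fin n → ℝ) × (Fin n → ℝ)) : IsOpen (openBox p) :=
  isOpen_set_pi finite_univ fun _ _ => isOpen_Ioo

lemma measurableSet_openBox (p : (Fin n → ℝ) × (Fin n → ℝ)) : MeasurableSet (openBox p) :=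
  (isOpen_openBox p).measurableSet

lemma volume_openBox (p : (Fin n → ℝ) × (Fin n → ℝ)) :
    volume (openBox p) = ∏ i, ENNReal.ofReal (p.2 i - p.1 i) := by
  simp [openBox, volume_pi_pi]

lemma volume_openBox_ne_top (p : (Fin n → ℝ) × (Fin n → ℝ)) : volume (openBox p) ≠ ∞ := by
  rw [volume_openBox]
  exact ENNReal.prod_ne_top fun _ _ => ENNReal.ofReal_ne_top

lemma openBox_nonempty {p : (Fin n → ℝ) × (Fin n → ℝ)} (hp : ∀ i, p.1 i < p.2 i) :
    (openBox p).Nonempty :=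
  univ_pi_nonempty_iff.2 fun i => nonempty_Ioo.2 (hp i)

lemma volume_openBox_pos {p : (Fin n → ℝ) × (Fin n → ℝ)} (hp : ∀ i, p.1 i < p.2 i) :
    0 < volume (openBox p) :=
  (isOpen_openBox p).measure_pos _ (openBox_nonempty hp)

lemma haloBound_ratBox {ε : ℝ} (h0 : 0 < ε) (h1 : ε < 1) (n : ℕ) :
    HaloBound volume (ratBox (n := n)) (ENNReal.ofReal ε ^ n)
      (ENNReal.ofReal ((1 + ε) / (1 - ε)) ^ n) := by
  induction n with
  | zero =>
    intro E _
    simp only [pow_zero, one_mul]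
    refine measure_mono fun x hx => ?_
    rcases mem_levelHalo.1 hx with hx | ⟨i, hi, hx⟩
    · exact hx
    · by_contra hxE
      have : ratBox i \ E = ratBox i := by
        ext y
        rw [Subsingleton.elim y x]
        simp [hxE]
      simp [this] at hi
  | succ n ih =>
    have h := (haloBound_Ioo h0 h1).prod (fun p => measurableSet_Ioo)
      (fun p => measurableSet_openBox _) ih
    rw [pow_succ', pow_succ']
    refine HaloBound.of_measurePreserving (MeasurableEquiv.piFinSuccAbove (fun _ => ℝ) 0)
      (volume_preserving_piFinSuccAbove (fun _ => ℝ) 0) ?_ h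
    intro p
    refine ⟨((p.1 0, p.2 0), (fun i => p.1 i.succ, fun i => p.2 i.succ)), ?_⟩
    ext x
    simp [ratBox, mem_openBox, MeasurableEquiv.piFinSuccAbove, Fin.forall_fin_succ, Fin.tail]

/-- A box is exhausted by the rational boxes inside it, also in terms of measure. -/
lemma exists_ratBox_subset {p : (Fin n → ℝ) × (Fin n → ℝ)} {x : Fin n → ℝ} (hx : x ∈ openBox p)
    {c : ℝ≥0∞} (e : ℝ≥0∞) (hc : c < e * volume (openBox p)) :
    ∃ q, ratBox q ⊆ openBox p ∧ x ∈ ratBox q ∧ c < e * volume (ratBox q) := by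
  let J := {q : (Fin n → ℚ) × (Fin n → ℚ) // ∀ i, p.1 i < q.1 i ∧ (q.2 i : ℝ) < p.2 i}
  have hsub : ∀ q : J, ratBox q.1 ⊆ openBox p := fun q y hy => mem_openBox.2 fun i =>
    ⟨(q.2 i).1.trans (mem_openBox.1 hy i).1, (mem_openBox.1 hy i).2.trans (q.2 i).2⟩
  have hdir : Directed (· ⊆ ·) fun q : J => ratBox q.1 := by
    intro q r
    refine ⟨⟨(q.1.1 ⊓ r.1.1, q.1.2 ⊔ r.1.2), fun i => ?_⟩, ?_, ?_⟩
    · simp [q.2 i, r.2 i]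
    · exact fun y hy => mem_openBox.2 fun i => by simp [(mem_openBox.1 hy i).1, (mem_openBox.1 hy i).2]
    · exact fun y hy => mem_openBox.2 fun i => by simp [(mem_openBox.1 hy i).1, (mem_openBox.1 hy i).2]
  have hcov : ∀ y ∈ openBox p, ∃ q : J, y ∈ ratBox q.1 := by
    intro y hy
    choose a ha using fun i => exists_rat_btwn (mem_openBox.1 hy i).1
    choose b hb using fun i => exists_rat_btwn (mem_openBox.1 hy i).2
    exact ⟨⟨(a, b), fun i => ⟨(ha i).1, (hb i).2⟩⟩, mem_openBox.2 fun i => ⟨(ha i).2, (hb i).1⟩⟩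
  have hU : openBox p = ⋃ q : J, ratBox q.1 :=
    subset_antisymm (fun y hy => mem_iUnion.2 (hcov y hy)) (iUnion_subset hsub)
  rw [hU, hdir.measure_iUnion, ENNReal.mul_iSup] at hc
  obtain ⟨q, hq⟩ := lt_iSup_iff.1 hc
  obtain ⟨r, hr⟩ := hcov x hx
  -- `q` has enough measure and `r` contains `x`; a common enlargement does both.
  obtain ⟨s, hqs, hrs⟩ := hdir q r
  exact ⟨s.1, hsub s, hrs hr, hq.trans_le (by gcongr)⟩

/-- The strict inequality survives approximation of the box from inside, so the countable family
needed for the product argument loses nothing. -/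
lemma levelHalo_openBox_subset (e : ℝ≥0∞) (E : Set (Fin n → ℝ)) :
    levelHalo volume openBox e E ⊆ levelHalo volume ratBox e E := by
  intro x hx
  rcases mem_levelHalo.1 hx with hx | ⟨p, hp, hx⟩
  · exact subset_levelHalo hx
  obtain ⟨q, hqp, hxq, hq⟩ := exists_ratBox_subset hx e hp
  exact subset_levelHalo_of_lt ((measure_mono (sdiff_subset_sdiff_left hqp)).trans_lt hq) hxq

/-- The quantitative Solyanik estimate for the strong maximal operator. -/
lemma haloBound_openBox {ε : ℝ} (h0 : 0 < ε) (h1 : ε < 1) (n : ℕ) :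
    HaloBound volume (openBox (n := n)) (ENNReal.ofReal ε ^ n)
      (ENNReal.ofReal ((1 + ε) / (1 - ε)) ^ n) := fun E hE =>
  (measure_mono (levelHalo_openBox_subset _ E)).trans (haloBound_ratBox h0 h1 n E hE)

lemma measurableSet_levelHalo_openBox {E : Set (Fin n → ℝ)} (hE : MeasurableSet E) (e : ℝ≥0∞) :
    MeasurableSet (levelHalo volume openBox e E) :=
  hE.union (isOpen_iUnion fun p => isOpen_iUnion fun _ => isOpen_openBox p).measurableSet

lemma mem_haloSet_strongBasis {t : ℝ} {E : Set (Fin n → ℝ)} (hE : MeasurableSet E)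
    {x : Fin n → ℝ} :
    x ∈ haloSet (strongBasis n) t E ↔ ∃ p : (Fin n → ℝ) × (Fin n → ℝ), (∀ i, p.1 i < p.2 i) ∧
      x ∈ openBox p ∧ ENNReal.ofReal t * volume (openBox p) < volume (openBox p ∩ E) := by
  have key : ∀ R : Set (Fin n → ℝ), MeasurableSet R →
      ∫⁻ y in R, ‖E.indicator (fun _ => (1 : ℝ)) y‖ₑ = volume (R ∩ E) := by
    intro R hR
    have : ∀ y, ‖E.indicator (fun _ => (1 : ℝ)) y‖ₑ = E.indicator 1 y := by
      intro y
      by_cases hy : y ∈ E <;> simp [hy]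
    simp_rw [this]
    rw [lintegral_indicator_one hE, Measure.restrict_apply hE, inter_comm]
  simp only [haloSet, maximalOperator, mem_ofPred_eq, lt_iSup_iff, strongBasis]
  constructor
  · rintro ⟨_, ⟨⟨a, b, hab, rfl⟩, hx⟩, h⟩
    refine ⟨(a, b), hab, hx, ?_⟩
    change _ < (∫⁻ y in openBox (a, b), _) / volume (openBox (a, b)) at h
    rw [key _ (measurableSet_openBox (a, b))] at h
    exact (ENNReal.lt_div_iff_mul_lt (Or.inl (volume_openBox_pos (p := (a, b)) hab).ne')
      (Or.inl (volume_openBox_ne_top (a, b)))).1 h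
  · rintro ⟨p, hp, hx, h⟩
    refine ⟨openBox p, ⟨⟨p.1, p.2, hp, rfl⟩, hx⟩, ?_⟩
    rw [key _ (measurableSet_openBox p)]
    exact (ENNReal.lt_div_iff_mul_lt (Or.inl (volume_openBox_pos hp).ne')
      (Or.inl (volume_openBox_ne_top p))).2 h

/-! ### Homothetic copies of a box -/

/-- The box `(1 - s) x + s R` obtained by shrinking the box `R` towards `x`. -/
def shrinkBox (p : (Fin n → ℝ) × (Fin n → ℝ)) (x : Fin n → ℝ) (s : ℝ) :
    (Fin n → ℝ) × (Fin n → ℝ) :=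
  (fun i => x i - s * (x i - p.1 i), fun i => x i + s * (p.2 i - x i))

lemma mem_openBox_shrinkBox {p : (Fin n → ℝ) × (Fin n → ℝ)} {x : Fin n → ℝ} {s : ℝ}
    (hx : x ∈ openBox p) (hs : 0 < s) : x ∈ openBox (shrinkBox p x s) := by
  refine mem_openBox.2 fun i => ?_
  have h := mem_openBox.1 hx i
  simp only [shrinkBox]
  constructor
  · nlinarith [mul_pos hs (sub_pos.2 h.1)]
  · nlinarith [mul_pos hs (sub_pos.2 h.2)]

lemma openBox_shrinkBox_mono {p : (Fin n → ℝ) × (Fin n → ℝ)} {x : Fin n → ℝ} {s t : ℝ}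
    (hx : x ∈ openBox p) (hst : s ≤ t) :
    openBox (shrinkBox p x s) ⊆ openBox (shrinkBox p x t) := by
  refine fun y hy => mem_openBox.2 fun i => ?_
  have h := mem_openBox.1 hx i
  have h' := mem_openBox.1 hy i
  simp only [shrinkBox] at h' ⊢
  constructor
  · nlinarith [mul_le_mul_of_nonneg_right hst (sub_pos.2 h.1).le]
  · nlinarith [mul_le_mul_of_nonneg_right hst (sub_pos.2 h.2).le]

lemma shrinkBox_one (p : (Fin n → ℝ) × (Fin n → ℝ)) (x : Fin n → ℝ) : shrinkBox p x 1 = p := by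
  simp [shrinkBox]

lemma volume_openBox_shrinkBox (p : (Fin n → ℝ) × (Fin n → ℝ)) (x : Fin n → ℝ) {s : ℝ}
    (hs : 0 ≤ s) : volume (openBox (shrinkBox p x s)) =
      ENNReal.ofReal (s ^ n) * volume (openBox p) := by
  rw [volume_openBox, volume_openBox]
  have : ∀ i, ENNReal.ofReal ((shrinkBox p x s).2 i - (shrinkBox p x s).1 i) =
      ENNReal.ofReal s * ENNReal.ofReal (p.2 i - p.1 i) := by
    intro i
    rw [← ENNReal.ofReal_mul hs]
    congr 1
    simp only [shrinkBox]
    ring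
  simp_rw [this]
  rw [Finset.prod_mul_distrib, Finset.prod_const, Finset.card_univ, Fintype.card_fin,
    ENNReal.ofReal_pow hs]

/-- The box with the same centre as `shrinkBox p x s` and five times its side lengths. -/
def fiveBox (p : (Fin n → ℝ) × (Fin n → ℝ)) (x : Fin n → ℝ) (s : ℝ) :
    (Fin n → ℝ) × (Fin n → ℝ) :=
  (fun i => x i - s * (x i - p.1 i) - 2 * s * (p.2 i - p.1 i),
    fun i => x i + s * (p.2 i - x i) + 2 * s * (p.2 i - p.1 i))

lemma volume_openBox_fiveBox (p : (Fin n → ℝ) × (Fin n → ℝ)) (x : Fin n → ℝ) {s : ℝ} :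
    volume (openBox (fiveBox p x s)) = 5 ^ n * volume (openBox (shrinkBox p x s)) := by
  rw [volume_openBox, volume_openBox]
  have : ∀ i, ENNReal.ofReal ((fiveBox p x s).2 i - (fiveBox p x s).1 i) =
      5 * ENNReal.ofReal ((shrinkBox p x s).2 i - (shrinkBox p x s).1 i) := by
    intro i
    rw [← ENNReal.ofReal_ofNat 5, ← ENNReal.ofReal_mul (by norm_num)]
    congr 1
    simp only [shrinkBox, fiveBox]
    ring
  simp_rw [this]
  rw [Finset.prod_mul_distrib, Finset.prod_const, Finset.card_univ, Fintype.card_fin]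

/-- All copies have sides proportional to those of one box, so a single parameter measures their
size and Vitali covering applies, as it would not for arbitrary boxes. -/
lemma openBox_shrinkBox_subset_fiveBox {p : (Fin n → ℝ) × (Fin n → ℝ)} (hp : ∀ i, p.1 i < p.2 i)
    {x y : Fin n → ℝ} {s t : ℝ} (hst : s ≤ 2 * t)
    (h : (openBox (shrinkBox p x s) ∩ openBox (shrinkBox p y t)).Nonempty) :
    openBox (shrinkBox p x s) ⊆ openBox (fiveBox p y t) := by
  obtain ⟨z, hzx, hzy⟩ := h
  refine fun w hw => mem_openBox.2 fun i => ?_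
  have h1 := mem_openBox.1 hzx i
  have h2 := mem_openBox.1 hzy i
  have h3 := mem_openBox.1 hw i
  have h4 := mul_le_mul_of_nonneg_right hst (sub_pos.2 (hp i)).le
  simp only [shrinkBox, fiveBox] at h1 h2 h3 ⊢
  constructor <;> nlinarith

end OpenBox

/-! ### Growth of a set inside a box that it does not fill -/

section Growth

open Filter Topology Metric

variable {n : ℕ}

/-- At almost every point `x` of `E`, the boxes shrinking homothetically to `x` are eventually
nearly filled by `E`. -/
lemma ae_eventually_shrinkBox_sdiff_lt {E : Set (Fin n → ℝ)} (hE : MeasurableSet E)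
    {p : (Fin n → ℝ) × (Fin n → ℝ)} (hp : ∀ i, p.1 i < p.2 i) {δ : ℝ≥0∞} (hδ : δ ≠ 0) :
    ∀ᵐ x ∂volume.restrict E, x ∈ openBox p → ∀ᶠ s in 𝓝[>] (0 : ℝ),
      volume (openBox (shrinkBox p x s) \ E) < δ * volume (openBox (shrinkBox p x s)) := by
  filter_upwards [IsUnifLocDoublingMeasure.ae_tendsto_measure_inter_div volume E 1] with x hx hxp
  have hlim := hx (l := 𝓝[>] (0 : ℝ)) (fun _ => x) id tendsto_id (by
    filter_upwards [self_mem_nhdsWithin] with r hr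
    exact mem_closedBall_self (by simpa using le_of_lt hr))
  obtain ⟨L, hL0, hL⟩ : ∃ L : ℝ, 0 < L ∧ ∀ i, p.2 i - p.1 i ≤ L := by
    refine ⟨1 + ∑ i, (p.2 i - p.1 i), ?_, fun i => ?_⟩
    · have := Finset.sum_nonneg fun i (_ : i ∈ Finset.univ) => (sub_pos.2 (hp i)).le
      linarith
    · have := Finset.single_le_sum (f := fun i => p.2 i - p.1 i)
        (fun i _ => (sub_pos.2 (hp i)).le) (Finset.mem_univ i)
      linarith
  have hball0 : volume (closedBall x L) ≠ 0 := (measure_closedBall_pos volume x hL0).ne'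
  have hballt : volume (closedBall x L) ≠ ∞ := measure_closedBall_lt_top.ne
  -- The shrunken box lies in the ball of radius `s * L` and occupies a proportion of it independent
  -- of `s`. With this `η`, a defect `η` in the ball is a defect `δ` in the box.
  set η : ℝ≥0∞ := δ * volume (openBox p) / volume (closedBall x L) with hη
  have hη0 : η ≠ 0 :=
    (ENNReal.div_pos (mul_ne_zero hδ (volume_openBox_pos hp).ne') hballt).ne'
  have hev := hlim.eventually (lt_mem_nhds (ENNReal.sub_lt_self ENNReal.one_ne_top one_ne_zero hη0))
  have hmul : Tendsto (fun s : ℝ => s * L) (𝓝[>] 0) (𝓝[>] 0) := by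
    refine tendsto_nhdsWithin_iff.2 ⟨?_, ?_⟩
    · have : Tendsto (fun s : ℝ => s * L) (𝓝 0) (𝓝 (0 * L)) :=
        (continuous_id.mul continuous_const).tendsto 0
      rw [zero_mul] at this
      exact this.mono_left nhdsWithin_le_nhds
    · filter_upwards [self_mem_nhdsWithin] with s hs
      exact mul_pos hs hL0
  filter_upwards [hmul.eventually hev, self_mem_nhdsWithin] with s hs hs0
  have hs0 : 0 < s := hs0
  simp only [id] at hs
  set D := closedBall x (s * L) with hD
  have hD0 : volume D ≠ 0 := (measure_closedBall_pos volume x (mul_pos hs0 hL0)).ne'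
  have hDt : volume D ≠ ∞ := measure_closedBall_lt_top.ne
  have hDv : volume D = ENNReal.ofReal (s ^ n) * volume (closedBall x L) := by
    rw [hD, Real.volume_pi_closedBall _ (mul_pos hs0 hL0).le, Real.volume_pi_closedBall _ hL0.le,
      ← ENNReal.ofReal_mul (by positivity), Fintype.card_fin, ← mul_pow]
    congr 2
    ring
  have hsub : openBox (shrinkBox p x s) ⊆ D := by
    intro y hy
    rw [hD, mem_closedBall, dist_pi_le_iff (mul_pos hs0 hL0).le]
    intro i
    have h1 := mem_openBox.1 hy i
    have h2 := mem_openBox.1 hxp i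
    have h3 := hL i
    simp only [shrinkBox] at h1
    rw [Real.dist_eq, abs_le]
    constructor <;> nlinarith
  have hlt : volume (D \ E) < η * volume D := by
    rw [ENNReal.lt_div_iff_mul_lt (Or.inl hD0) (Or.inl hDt)] at hs
    by_contra hcon
    rw [not_lt] at hcon
    have hfin : volume (D \ E) ≠ ∞ := measure_ne_top_of_subset sdiff_subset hDt
    have h1 : η * volume D + (1 - η) * volume D < volume (D \ E) + volume (E ∩ D) :=
      ENNReal.add_lt_add_of_le_of_lt (ne_top_of_le_ne_top hfin hcon) hcon hs
    rw [inter_comm, add_comm (volume (D \ E)), measure_inter_add_sdiff _ hE, ← add_mul] at h1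
    refine absurd h1 (not_lt.2 ?_)
    calc volume D = 1 * volume D := (one_mul _).symm
      _ ≤ (η + (1 - η)) * volume D := by gcongr; exact le_add_tsub
  calc volume (openBox (shrinkBox p x s) \ E) ≤ volume (D \ E) :=
        measure_mono (sdiff_subset_sdiff_left hsub)
    _ < η * volume D := hlt
    _ = δ * volume (openBox (shrinkBox p x s)) := by
        rw [hDv, volume_openBox_shrinkBox _ _ hs0.le, hη, mul_left_comm,
          ENNReal.div_mul_cancel hball0 hballt]
        ring

/-- Shrink by a ratio so close to 1 that one step removes at most the proportion δ of the volume,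
and stop just before the missing proportion first drops below δ. It is then still below 2δ. -/
lemma exists_shrinkBox_stopping {E : Set (Fin n → ℝ)} {p : (Fin n → ℝ) × (Fin n → ℝ)}
    {δ : ℝ} (h0 : 0 < δ) (h1 : δ < 1)
    (h : ENNReal.ofReal δ * volume (openBox p) ≤ volume (openBox p \ E)) {x : Fin n → ℝ}
    (hx : x ∈ openBox p)
    (hd : ∀ᶠ s in 𝓝[>] (0 : ℝ), volume (openBox (shrinkBox p x s) \ E) <
      ENNReal.ofReal δ * volume (openBox (shrinkBox p x s))) :
    ∃ s : ℝ, 0 < s ∧ s ≤ 1 ∧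
      ENNReal.ofReal δ * volume (openBox (shrinkBox p x s)) ≤
        volume (openBox (shrinkBox p x s) \ E) ∧
      volume (openBox (shrinkBox p x s) \ E) <
        ENNReal.ofReal (2 * δ) * volume (openBox (shrinkBox p x s)) := by
  classical
  -- Bernoulli's inequality gives θ^n ≥ 1 - δ; `n + 1` instead of `n` keeps θ < 1 when `n = 0`.
  set θ : ℝ := 1 + -(δ / (n + 1)) with hθ
  have hn : (0 : ℝ) < n + 1 := by positivity
  have hq : δ / (n + 1) ≤ δ := div_le_self h0.le (by linarith [n.cast_nonneg (α := ℝ)])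
  have hq0 : 0 < δ / (n + 1) := by positivity
  have hθ0 : 0 < θ := by linarith
  have hθ1 : θ < 1 := by linarith
  have hθn : 1 - δ ≤ θ ^ n := by
    refine le_trans ?_ (one_add_mul_le_pow (by linarith) n)
    have : n * (δ / (n + 1)) ≤ δ := by
      rw [mul_div_assoc', div_le_iff₀ hn]
      nlinarith
    linarith
  have hex : ∃ k : ℕ, volume (openBox (shrinkBox p x (θ ^ k)) \ E) <
      ENNReal.ofReal δ * volume (openBox (shrinkBox p x (θ ^ k))) := by
    have hlim : Tendsto (fun k : ℕ => θ ^ k) atTop (𝓝[>] 0) :=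
      tendsto_nhdsWithin_iff.2 ⟨tendsto_pow_atTop_nhds_zero_of_lt_one hθ0.le hθ1,
        .of_forall fun k => pow_pos hθ0 k⟩
    exact (hlim.eventually hd).exists
  obtain ⟨m, hm⟩ : ∃ m, Nat.find hex = m + 1 := by
    refine Nat.exists_eq_succ_of_ne_zero fun h' => ?_
    have := Nat.find_spec hex
    rw [h', pow_zero, shrinkBox_one] at this
    exact absurd this (not_lt.2 h)
  have hmin := Nat.find_min hex (m := m) (by omega)
  have hspec := Nat.find_spec hex
  rw [hm] at hspec
  have hs0 : 0 < θ ^ m := pow_pos hθ0 m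
  refine ⟨θ ^ m, hs0, pow_le_one₀ hθ0.le hθ1.le, not_lt.1 hmin, ?_⟩
  set Q := openBox (shrinkBox p x (θ ^ m)) with hQ
  set Q' := openBox (shrinkBox p x (θ ^ (m + 1))) with hQ'
  have hsub : Q' ⊆ Q := openBox_shrinkBox_mono hx (pow_le_pow_of_le_one hθ0.le hθ1.le (by omega))
  have hQt : volume Q ≠ ∞ := volume_openBox_ne_top _
  have hv : volume Q' = ENNReal.ofReal (θ ^ n) * volume Q := by
    rw [hQ, hQ', volume_openBox_shrinkBox _ _ hs0.le, volume_openBox_shrinkBox _ _ (by positivity),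
      ← mul_assoc, ← ENNReal.ofReal_mul (by positivity), ← mul_pow, ← pow_succ']
  have hdiff : volume (Q \ Q') ≤ ENNReal.ofReal δ * volume Q := by
    rw [measure_sdiff hsub (measurableSet_openBox _).nullMeasurableSet (volume_openBox_ne_top _),
      tsub_le_iff_right, hv, ← add_mul, ← ENNReal.ofReal_add h0.le (by positivity)]
    calc volume Q = 1 * volume Q := (one_mul _).symm
      _ ≤ _ := by
        gcongr
        rw [ENNReal.one_le_ofReal]
        linarith
  calc volume (Q \ E) ≤ volume (Q' \ E ∪ Q \ Q') := by
        refine measure_mono fun y hy => ?_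
        by_cases hy' : y ∈ Q'
        exacts [Or.inl ⟨hy', hy.2⟩, Or.inr ⟨hy.1, hy'⟩]
    _ ≤ volume (Q' \ E) + volume (Q \ Q') := measure_union_le _ _
    _ < ENNReal.ofReal δ * volume Q + ENNReal.ofReal δ * volume Q := by
        refine ENNReal.add_lt_add_of_lt_of_le (ne_top_of_le_ne_top
          (ENNReal.mul_ne_top ENNReal.ofReal_ne_top hQt) hdiff)
          (hspec.trans_le (by gcongr)) hdiff
    _ = ENNReal.ofReal (2 * δ) * volume Q := by
        rw [ENNReal.ofReal_mul (by norm_num), ENNReal.ofReal_ofNat]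
        ring

/-- If `E` does not nearly fill a box, then passing from `E` to its level halo increases the
measure of `E` inside the box by a definite proportion. -/
lemma measure_inter_le_measure_levelHalo_sdiff {E : Set (Fin n → ℝ)} (hE : MeasurableSet E)
    {p : (Fin n → ℝ) × (Fin n → ℝ)} (hp : ∀ i, p.1 i < p.2 i) {δ : ℝ} (h0 : 0 < δ) (h1 : δ < 1)
    (h : ENNReal.ofReal δ * volume (openBox p) ≤ volume (openBox p \ E)) :
    ENNReal.ofReal δ * volume (openBox p ∩ E) ≤
      5 ^ n * volume ((openBox p ∩ levelHalo volume openBox (ENNReal.ofReal (2 * δ)) E) \ E) := by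
  set G : Set (Fin n → ℝ) := {x | x ∈ openBox p ∧ ∀ᶠ s in 𝓝[>] (0 : ℝ),
    volume (openBox (shrinkBox p x s) \ E) <
      ENNReal.ofReal δ * volume (openBox (shrinkBox p x s))} with hG
  have hGae : (openBox p ∩ E : Set (Fin n → ℝ)) ≤ᵐ[volume] G := by
    have := ae_eventually_shrinkBox_sdiff_lt hE hp (ENNReal.ofReal_pos.2 h0).ne'
    rw [ae_restrict_iff' hE] at this
    filter_upwards [this] with x hx hxE
    exact ⟨hxE.1, hx hxE.2 hxE.1⟩
  have hst : ∀ x ∈ G, ∃ s : ℝ, 0 < s ∧ s ≤ 1 ∧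
      ENNReal.ofReal δ * volume (openBox (shrinkBox p x s)) ≤
        volume (openBox (shrinkBox p x s) \ E) ∧
      volume (openBox (shrinkBox p x s) \ E) <
        ENNReal.ofReal (2 * δ) * volume (openBox (shrinkBox p x s)) :=
    fun x hx => exists_shrinkBox_stopping h0 h1 h hx.1 hx.2
  choose! s hs0 hs1 hsδ hs2 using hst
  set Q : (Fin n → ℝ) → Set (Fin n → ℝ) := fun x => openBox (shrinkBox p x (s x)) with hQ
  have hne : ∀ x ∈ G, (Q x).Nonempty := fun x hx => ⟨x, mem_openBox_shrinkBox hx.1 (hs0 x hx)⟩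
  -- The stopped boxes lie in the given box and in the level halo, and each misses at least the
  -- proportion δ. A disjoint subfamily, enlarged five times, covers almost all of E in the box.
  obtain ⟨u, huG, hdisj, hcov⟩ := Vitali.exists_disjoint_subfamily_covering_enlargement Q G s 2
    one_lt_two (fun x hx => (hs0 x hx).le) 1 hs1 hne
  have hucount : u.Countable := hdisj.countable_of_isOpen (fun x _ => isOpen_openBox _)
    fun x hx => hne x (huG hx)
  have hGcov : G ⊆ ⋃ y ∈ u, openBox (fiveBox p y (s y)) := by
    intro x hx
    obtain ⟨y, hy, hxy, hsxy⟩ := hcov x hx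
    exact mem_iUnion₂.2 ⟨y, hy, openBox_shrinkBox_subset_fiveBox hp hsxy hxy
      (mem_openBox_shrinkBox hx.1 (hs0 x hx))⟩
  have := hucount.to_subtype
  calc ENNReal.ofReal δ * volume (openBox p ∩ E)
      ≤ ENNReal.ofReal δ * ∑' y : u, volume (openBox (fiveBox p y (s y))) := by
        gcongr
        calc volume (openBox p ∩ E) ≤ volume G := measure_mono_ae hGae
          _ ≤ volume (⋃ y ∈ u, openBox (fiveBox p y (s y))) := measure_mono hGcov
          _ ≤ _ := measure_biUnion_le volume hucount _
    _ = 5 ^ n * ∑' y : u, ENNReal.ofReal δ * volume (Q y) := by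
        simp_rw [volume_openBox_fiveBox, ENNReal.tsum_mul_left, hQ]
        ring
    _ ≤ 5 ^ n * ∑' y : u, volume (Q y \ E) := by
        gcongr with y
        exact hsδ y (huG y.2)
    _ = 5 ^ n * volume (⋃ y ∈ u, Q y \ E) := by
        rw [measure_biUnion hucount (fun x hx y hy hxy =>
          (hdisj hx hy hxy).mono sdiff_subset sdiff_subset)
          fun y _ => (measurableSet_openBox _).diff hE]
    _ ≤ _ := by
        gcongr
        refine iUnion₂_subset fun y hy z hz => ⟨⟨?_, ?_⟩, hz.2⟩
        · have := openBox_shrinkBox_mono (huG hy).1 (hs1 y (huG hy)) hz.1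
          rwa [shrinkBox_one] at this
        · exact subset_levelHalo_of_lt (hs2 y (huG hy)) hz.1

end Growth

lemma HaloBound.anti {X ι : Type*} [MeasurableSpace X] {μ : Measure X} {B : ι → Set X}
    {e e' C : ℝ≥0∞} (he : e ≤ e') (h : HaloBound μ B e' C) : HaloBound μ B e C := by
  refine fun E hE => (measure_mono fun x hx => ?_).trans (h E hE)
  rcases mem_levelHalo.1 hx with hx | ⟨i, hi, hx⟩
  · exact subset_levelHalo hx
  · exact subset_levelHalo_of_lt (hi.trans_le (by gcongr)) hx

lemma div_pow_le_one_add_mul {ε : ℝ} (h0 : 0 ≤ ε) (h1 : ε ≤ 1 / 2) (n : ℕ) :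
    ((1 + ε) / (1 - ε)) ^ n ≤ 1 + 2 * 3 ^ n * ε := by
  have hbase : (1 + ε) / (1 - ε) ≤ 1 + 4 * ε := by
    rw [div_le_iff₀ (by linarith)]
    nlinarith
  have hbase0 : 0 ≤ (1 + ε) / (1 - ε) := div_nonneg (by linarith) (by linarith)
  -- The sharper constant K satisfies 3K + 4 = 2 * 3^(n+1) - 2, which closes the induction since
  -- 4Kε² ≤ 2Kε.
  suffices ((1 + ε) / (1 - ε)) ^ n ≤ 1 + (2 * 3 ^ n - 2) * ε by nlinarith
  induction n with
  | zero => simp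
  | succ n ih =>
    have h3 : (1 : ℝ) ≤ 3 ^ n := one_le_pow₀ (by norm_num)
    have hK : 0 ≤ (2 * 3 ^ n - 2) * ε := mul_nonneg (by linarith) h0
    calc ((1 + ε) / (1 - ε)) ^ (n + 1) ≤ (1 + (2 * 3 ^ n - 2) * ε) * (1 + 4 * ε) := by
          rw [pow_succ]
          exact mul_le_mul ih hbase hbase0 (by linarith)
      _ ≤ 1 + (2 * 3 ^ (n + 1) - 2) * ε := by
          rw [pow_succ]
          nlinarith [mul_le_mul_of_nonneg_left h1 hK]

/-! ### Estimates for the halo function -/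

section HaloFunction

variable {n : ℕ}

lemma haloBound_openBox_rpow (hn : 1 ≤ n) {η : ℝ} (h0 : 0 < η) (h1 : η < 1) :
    HaloBound volume (openBox (n := n)) (ENNReal.ofReal η)
      (ENNReal.ofReal (((1 + η ^ (1 / (n : ℝ))) / (1 - η ^ (1 / (n : ℝ)))) ^ n)) := by
  have hn' : (0 : ℝ) < n := by exact_mod_cast hn
  have hε0 : 0 < η ^ (1 / (n : ℝ)) := Real.rpow_pos_of_pos h0 _
  have hε1 : η ^ (1 / (n : ℝ)) < 1 := Real.rpow_lt_one h0.le h1 (by positivity)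
  have h := haloBound_openBox hε0 hε1 n
  have hpow : (η ^ (1 / (n : ℝ))) ^ n = η := by
    rw [one_div]
    exact Real.rpow_inv_natCast_pow h0.le (by omega)
  rwa [← ENNReal.ofReal_pow hε0.le, hpow,
    ← ENNReal.ofReal_pow (div_nonneg (by linarith) (by linarith))] at h

/-- The Solyanik estimate for the strong maximal operator. -/
lemma haloBound_openBox_one_add (hn : 1 ≤ n) {η : ℝ} (h0 : 0 < η) (h1 : η ≤ (1 / 2) ^ n) :
    HaloBound volume (openBox (n := n)) (ENNReal.ofReal η)
      (ENNReal.ofReal (1 + 2 * 3 ^ n * η ^ (1 / (n : ℝ)))) := by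
  have hlt : η < 1 := h1.trans_lt (pow_lt_one₀ (by norm_num) (by norm_num) (by omega))
  refine fun E hE => (haloBound_openBox_rpow hn h0 hlt E hE).trans ?_
  gcongr
  refine div_pow_le_one_add_mul (Real.rpow_nonneg h0.le _) ?_ n
  calc η ^ (1 / (n : ℝ)) ≤ ((1 / 2 : ℝ) ^ n) ^ (1 / (n : ℝ)) := by gcongr
    _ = 1 / 2 := by
      rw [one_div (n : ℝ)]
      exact Real.pow_rpow_inv_natCast (by norm_num) (by omega)

lemma haloSet_subset_levelHalo {E : Set (Fin n → ℝ)} (hE : MeasurableSet E) {t η : ℝ}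
    (htη : 1 ≤ t + η) :
    haloSet (strongBasis n) t E ⊆ levelHalo volume openBox (ENNReal.ofReal η) E := by
  intro x hx
  obtain ⟨p, hp, hxp, h⟩ := (mem_haloSet_strongBasis hE).1 hx
  refine subset_levelHalo_of_lt ?_ hxp
  by_contra hcon
  rw [not_lt] at hcon
  have hfin : volume (openBox p \ E) ≠ ∞ :=
    measure_ne_top_of_subset sdiff_subset (volume_openBox_ne_top p)
  have h1 := ENNReal.add_lt_add_of_lt_of_le (ne_top_of_le_ne_top hfin hcon) h hcon
  rw [measure_inter_add_sdiff _ hE, ← add_mul] at h1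
  refine absurd h1 (not_lt.2 ?_)
  calc volume (openBox p) = 1 * volume (openBox p) := (one_mul _).symm
    _ ≤ (ENNReal.ofReal t + ENNReal.ofReal η) * volume (openBox p) := by
      gcongr
      refine le_trans ?_ ENNReal.ofReal_add_le
      rwa [ENNReal.one_le_ofReal]

/-- A box missing less than the proportion δ is swallowed by the level halo, which then has density
1 > 1/α there; in any other box the growth estimate raises the density by the factor β/α. -/
lemma haloSet_subset_haloSet_levelHalo {E : Set (Fin n → ℝ)} (hE : MeasurableSet E) {α β δ : ℝ}
    (hα : 1 < α) (h0 : 0 < δ) (h1 : δ < 1) (hδ : β = α * (1 + δ / 5 ^ n)) :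
    haloSet (strongBasis n) (1 / β) E ⊆ haloSet (strongBasis n) (1 / α)
      (levelHalo volume openBox (ENNReal.ofReal (2 * δ)) E) := by
  intro x hx
  obtain ⟨p, hp, hxp, h⟩ := (mem_haloSet_strongBasis hE).1 hx
  refine (mem_haloSet_strongBasis (measurableSet_levelHalo_openBox hE _)).2 ⟨p, hp, hxp, ?_⟩
  have hR0 := (volume_openBox_pos hp).ne'
  have hRt := volume_openBox_ne_top p
  have hγ : 0 < 1 + δ / 5 ^ n := by positivity
  by_cases hfull : volume (openBox p \ E) < ENNReal.ofReal δ * volume (openBox p)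
  · have hsub : openBox p ⊆ levelHalo volume openBox (ENNReal.ofReal (2 * δ)) E :=
      subset_levelHalo_of_lt (hfull.trans_le (by gcongr; linarith))
    rw [inter_eq_left.2 hsub]
    calc ENNReal.ofReal (1 / α) * volume (openBox p) < 1 * volume (openBox p) := by
          refine ENNReal.mul_lt_mul_left hR0 hRt ?_
          rw [ENNReal.ofReal_lt_one, div_lt_one (by linarith)]
          exact hα
      _ = volume (openBox p) := one_mul _
  · have hgrow := measure_inter_le_measure_levelHalo_sdiff hE hp h0 h1 (not_lt.1 hfull)
    set E' := levelHalo volume openBox (ENNReal.ofReal (2 * δ)) E with hE'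
    have hEE' : openBox p ∩ E' ∩ E = openBox p ∩ E := by
      rw [inter_assoc, inter_eq_right.2 (subset_levelHalo : E ⊆ E')]
    rw [← measure_inter_add_sdiff (openBox p ∩ E') hE, hEE']
    have h5 : ENNReal.ofReal (δ / 5 ^ n) * volume (openBox p ∩ E) ≤
        volume ((openBox p ∩ E') \ E) := by
      rw [ENNReal.ofReal_div_of_pos (by positivity), ENNReal.mul_div_right_comm.symm,
        ENNReal.ofReal_pow (by norm_num), ENNReal.ofReal_ofNat]
      exact ENNReal.div_le_of_le_mul' hgrow
    calc ENNReal.ofReal (1 / α) * volume (openBox p)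
        = ENNReal.ofReal (1 + δ / 5 ^ n) * (ENNReal.ofReal (1 / β) * volume (openBox p)) := by
          rw [← mul_assoc, ← ENNReal.ofReal_mul hγ.le]
          congr 2
          rw [hδ]
          field_simp
      _ < ENNReal.ofReal (1 + δ / 5 ^ n) * volume (openBox p ∩ E) :=
          ENNReal.mul_lt_mul_right (ENNReal.ofReal_pos.2 hγ).ne' ENNReal.ofReal_ne_top h
      _ = volume (openBox p ∩ E) + ENNReal.ofReal (δ / 5 ^ n) * volume (openBox p ∩ E) := by
          rw [ENNReal.ofReal_add zero_le_one (by positivity), ENNReal.ofReal_one, add_mul, one_mul]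
      _ ≤ _ := by gcongr

lemma haloFunction_le {B : Set (Set (Fin n → ℝ))} {α : ℝ} (hα : 1 < α) {D : ℝ≥0∞}
    (h : ∀ E, MeasurableSet E → 0 < volume E → volume E < ∞ →
      volume (haloSet B (1 / α) E) ≤ D * volume E) : haloFunction B α ≤ D := by
  rw [haloFunction, if_pos hα]
  exact iSup₂_le fun E hE => ENNReal.div_le_of_le_mul (h E hE.1 hE.2.1 hE.2.2)

lemma volume_haloSet_le {B : Set (Set (Fin n → ℝ))} {α : ℝ} (hα : 1 < α) {E : Set (Fin n → ℝ)}
    (hE : MeasurableSet E) (h0 : 0 < volume E) (ht : volume E < ∞) :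
    volume (haloSet B (1 / α) E) ≤ haloFunction B α * volume E := by
  rw [← ENNReal.div_le_iff h0.ne' ht.ne, haloFunction, if_pos hα]
  exact le_iSup₂ (f := fun E (_ : E ∈ {E : Set (Fin n → ℝ) | MeasurableSet E ∧ 0 < volume E ∧
    volume E < ∞}) => volume (haloSet B (1 / α) E) / volume E) E ⟨hE, h0, ht⟩

lemma haloFunction_of_le_one {B : Set (Set (Fin n → ℝ))} {α : ℝ} (hα : α ≤ 1) :
    haloFunction B α = ENNReal.ofReal α := if_neg (not_lt.2 hα)

lemma haloFunction_le_of_haloBound {α η : ℝ} (hα : 1 < α) (hη : 1 ≤ 1 / α + η) {C : ℝ≥0∞}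
    (h : HaloBound volume (openBox (n := n)) (ENNReal.ofReal η) C) :
    haloFunction (strongBasis n) α ≤ C :=
  haloFunction_le hα fun E hE _ _ =>
    (measure_mono (haloSet_subset_levelHalo hE hη)).trans (h E hE)

lemma haloFunction_strongBasis_lt_top (hn : 1 ≤ n) (α : ℝ) :
    haloFunction (strongBasis n) α < ∞ := by
  rcases le_or_gt α 1 with hα | hα
  · rw [haloFunction_of_le_one hα]
    exact ENNReal.ofReal_lt_top
  · have h1 : 1 / α < 1 := (div_lt_one (by linarith)).2 hα
    have h2 : 0 < 1 / α := by positivity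
    exact (haloFunction_le_of_haloBound hα (η := 1 - 1 / α) (by linarith)
      (haloBound_openBox_rpow hn (by linarith) (by linarith))).trans_lt ENNReal.ofReal_lt_top

lemma haloFunction_le_mul {α β δ : ℝ} (hα : 1 < α) (h0 : 0 < δ) (h1 : δ < 1)
    (hδ : β = α * (1 + δ / 5 ^ n)) {C : ℝ≥0∞} (hC : C ≠ ∞)
    (h : HaloBound volume (openBox (n := n)) (ENNReal.ofReal (2 * δ)) C) :
    haloFunction (strongBasis n) β ≤ haloFunction (strongBasis n) α * C := by
  have hβ : 1 < β := by
    have : 0 < δ / 5 ^ n := by positivity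
    rw [hδ]
    nlinarith
  refine haloFunction_le hβ fun E hE hE0 hEt => ?_
  have hE't := h E hE
  calc volume (haloSet (strongBasis n) (1 / β) E)
      ≤ volume (haloSet (strongBasis n) (1 / α)
          (levelHalo volume openBox (ENNReal.ofReal (2 * δ)) E)) :=
        measure_mono (haloSet_subset_haloSet_levelHalo hE hα h0 h1 hδ)
    _ ≤ haloFunction (strongBasis n) α *
          volume (levelHalo volume openBox (ENNReal.ofReal (2 * δ)) E) :=
        volume_haloSet_le hα (measurableSet_levelHalo_openBox hE _)
          (hE0.trans_le (measure_mono subset_levelHalo))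
          (hE't.trans_lt (ENNReal.mul_lt_top hC.lt_top hEt))
    _ ≤ haloFunction (strongBasis n) α * (C * volume E) := by gcongr
    _ = _ := (mul_assoc _ _ _).symm

lemma haloFunction_le_mul_one_add (hn : 1 ≤ n) {α β : ℝ} (hα : 1 ≤ α) (hαβ : α < β)
    (h : 2 * 5 ^ n * (β - α) ≤ (1 / 2) ^ n) :
    haloFunction (strongBasis n) β ≤ haloFunction (strongBasis n) α *
      ENNReal.ofReal (1 + 2 * 3 ^ n * (2 * 5 ^ n * (β - α)) ^ (1 / (n : ℝ))) := by
  have h5 : (1 : ℝ) ≤ 5 ^ n := one_le_pow₀ (by norm_num)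
  have hbound := haloBound_openBox_one_add hn (η := 2 * 5 ^ n * (β - α))
    (mul_pos (by positivity) (by linarith)) h
  -- At α = 1 the halo function is 1 by convention, so the Solyanik estimate applies directly, with
  -- 1 - 1/β ≤ β - 1.
  rcases hα.eq_or_lt with rfl | hα
  · rw [haloFunction_of_le_one le_rfl, ENNReal.ofReal_one, one_mul]
    refine haloFunction_le_of_haloBound hαβ ?_ hbound
    have h1 : 1 - 1 / β ≤ β - 1 := by
      rw [sub_le_iff_le_add, ← sub_le_iff_le_add', le_div_iff₀ (by linarith)]
      nlinarith [sq_nonneg (β - 1)]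
    nlinarith
  · have hα0 : 0 < α := by linarith
    -- The solution of β = α(1 + δ/5^n).
    set δ : ℝ := 5 ^ n * ((β - α) / α) with hδ
    have hδ0 : 0 < δ := mul_pos (by positivity) (div_pos (by linarith) hα0)
    have hle : (β - α) / α ≤ β - α := div_le_self (by linarith) hα.le
    have hδle : 2 * δ ≤ 2 * 5 ^ n * (β - α) := by
      rw [hδ, ← mul_assoc]
      gcongr
    have hδ1 : δ < 1 := by
      have : (1 / 2 : ℝ) ^ n ≤ 1 := pow_le_one₀ (by norm_num) (by norm_num)
      linarith
    refine haloFunction_le_mul hα hδ0 hδ1 ?_ ENNReal.ofReal_ne_top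
      (hbound.anti (ENNReal.ofReal_le_ofReal hδle))
    rw [hδ]
    field_simp
    ring

lemma one_le_haloFunction {α : ℝ} (hα : 1 < α) : 1 ≤ haloFunction (strongBasis n) α := by
  let p : (Fin n → ℝ) × (Fin n → ℝ) := (0, 1)
  have hp : ∀ i, p.1 i < p.2 i := fun i => zero_lt_one
  have h0 := volume_openBox_pos hp
  have ht := volume_openBox_ne_top p
  have hsub : openBox p ⊆ haloSet (strongBasis n) (1 / α) (openBox p) := by
    refine fun x hx => (mem_haloSet_strongBasis (measurableSet_openBox p)).2 ⟨p, hp, hx, ?_⟩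
    rw [inter_self]
    calc ENNReal.ofReal (1 / α) * volume (openBox p) < 1 * volume (openBox p) := by
          refine ENNReal.mul_lt_mul_left h0.ne' ht ?_
          rw [ENNReal.ofReal_lt_one, div_lt_one (by linarith)]
          exact hα
      _ = volume (openBox p) := one_mul _
  have h := (measure_mono hsub).trans (volume_haloSet_le hα (measurableSet_openBox p) h0 ht.lt_top)
  rwa [← ENNReal.div_le_iff h0.ne' ht, ENNReal.div_self h0.ne' ht] at h

lemma haloFunction_mono : Monotone (haloFunction (strongBasis n)) := by
  intro α β hαβ
  rcases le_or_gt α 1 with hα | hα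
  · rw [haloFunction_of_le_one hα]
    rcases le_or_gt β 1 with hβ | hβ
    · rw [haloFunction_of_le_one hβ]
      exact ENNReal.ofReal_le_ofReal hαβ
    · exact (ENNReal.ofReal_le_one.2 hα).trans (one_le_haloFunction hβ)
  · refine haloFunction_le hα fun E hE h0 ht =>
      (measure_mono fun x hx => ?_).trans (volume_haloSet_le (hα.trans_le hαβ) hE h0 ht)
    exact (ENNReal.ofReal_le_ofReal (one_div_le_one_div_of_le (by linarith) hαβ)).trans_lt hx

end HaloFunction

/-! ### From the multiplicative estimate to Hölder continuity -/

/-- A monotone function on `[0, ∞)` that is the identity on `[0, 1]` and satisfies a multiplicative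
Hölder estimate at small scales on `[1, ∞)` is locally Hölder continuous. -/
lemma locallyHolderOn_of_le_mul {F : ℝ → ℝ} {q : ℝ≥0} {c r : ℝ} (hmono : Monotone F)
    (hid : ∀ x, 0 ≤ x → x ≤ 1 → F x = x) (hq : q ≤ 1) (hc : 0 ≤ c) (hr : 0 < r)
    (hF : ∀ x y, 1 ≤ x → x < y → y - x ≤ r → F y ≤ F x * (1 + c * (y - x) ^ (q : ℝ))) :
    LocallyHolderOn q F (Ici 0) := by
  intro K hK hKc
  obtain ⟨A, hA⟩ := hKc.bddAbove
  have hF0 : F 0 = 0 := hid 0 le_rfl zero_le_one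
  have hq0 : 0 ≤ (q : ℝ) := q.coe_nonneg
  set M := F (max A 1) with hM
  have hM0 : 0 ≤ M := hF0 ▸ hmono (zero_le_one.trans (le_max_right A 1))
  set ρ := min r 1 with hρ
  have hρ0 : 0 < ρ := lt_min hr one_pos
  -- The three terms serve the multiplicative estimate above 1, the identity below 1 (where d ≤ d^q
  -- for d ≤ 1), and pairs at distance more than ρ. Close pairs on both sides of 1 are split at 1.
  set C : ℝ := M * c + 1 + M / ρ ^ (q : ℝ) with hC
  have hC1 : 0 ≤ M / ρ ^ (q : ℝ) := by positivity
  have hC0 : 0 ≤ C := by positivity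
  have key : ∀ x ∈ K, ∀ y ∈ K, x < y → F y - F x ≤ C * (y - x) ^ (q : ℝ) := by
    intro x hx y hy hxy
    have hx0 : 0 ≤ x := hK hx
    have hyM : F y ≤ M := hmono ((hA hy).trans (le_max_left _ _))
    have hFx0 : 0 ≤ F x := hF0 ▸ hmono hx0
    have hd : 0 < y - x := sub_pos.2 hxy
    have hdq : 0 ≤ (y - x) ^ (q : ℝ) := by positivity
    rcases lt_or_ge ρ (y - x) with hρd | hρd
    · have h1 : ρ ^ (q : ℝ) ≤ (y - x) ^ (q : ℝ) := Real.rpow_le_rpow hρ0.le hρd.le hq0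
      have h2 : M ≤ M / ρ ^ (q : ℝ) * (y - x) ^ (q : ℝ) := by
        rw [div_mul_eq_mul_div, le_div_iff₀ (by positivity)]
        gcongr
      have h3 : 0 ≤ (M * c + 1) * (y - x) ^ (q : ℝ) := by positivity
      rw [hC, add_mul]
      linarith
    · have hdle : y - x ≤ (y - x) ^ (q : ℝ) := by
        calc y - x = (y - x) ^ (1 : ℝ) := (Real.rpow_one _).symm
          _ ≤ _ := Real.rpow_le_rpow_of_exponent_ge hd (hρd.trans (min_le_right _ _))
            (by exact_mod_cast hq)
      have h3 : 0 ≤ M / ρ ^ (q : ℝ) * (y - x) ^ (q : ℝ) := by positivity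
      have h4 : 0 ≤ M * c * (y - x) ^ (q : ℝ) := by positivity
      have hstep : ∀ z, 1 ≤ z → x ≤ z → z < y → F y - F z ≤ M * c * (y - x) ^ (q : ℝ) := by
        intro z hz hxz hzy
        have h := hF z y hz hzy (by linarith [min_le_left r 1])
        have hzM : F z ≤ M := (hmono hzy.le).trans hyM
        have hz0 : 0 ≤ F z := hFx0.trans (hmono hxz)
        have hzd : 0 ≤ y - z := by linarith
        have : F z * (c * (y - z) ^ (q : ℝ)) ≤ M * (c * (y - x) ^ (q : ℝ)) := by gcongr
        linarith
      rw [hC, add_mul, add_mul, one_mul]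
      rcases le_or_gt y 1 with hy1 | hy1
      · rw [hid y (hx0.trans hxy.le) hy1, hid x hx0 (hxy.le.trans hy1)]
        linarith
      rcases le_or_gt x 1 with hx1 | hx1
      · have h5 := hstep 1 le_rfl hx1 hy1
        rw [hid 1 zero_le_one le_rfl] at h5
        rw [hid x hx0 hx1]
        linarith
      · have h5 := hstep x hx1.le le_rfl hxy
        linarith
  have key' : ∀ x ∈ K, ∀ y ∈ K, dist (F x) (F y) ≤ C * dist x y ^ (q : ℝ) := by
    intro x hx y hy
    rcases lt_trichotomy x y with h | rfl | h
    · rw [dist_comm, dist_comm x, Real.dist_eq, Real.dist_eq, abs_of_pos (sub_pos.2 h),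
        abs_of_nonneg (sub_nonneg.2 (hmono h.le))]
      exact key x hx y hy h
    · rw [dist_self]
      positivity
    · rw [Real.dist_eq, Real.dist_eq, abs_of_pos (sub_pos.2 h),
        abs_of_nonneg (sub_nonneg.2 (hmono h.le))]
      exact key y hy x hx h
  refine ⟨C.toNNReal, fun x hx y hy => ?_⟩
  rw [edist_dist, edist_dist, ENNReal.ofReal_rpow_of_nonneg dist_nonneg hq0,
    ← ENNReal.ofReal.eq_1, ← ENNReal.ofReal_mul hC0]
  exact ENNReal.ofReal_le_ofReal (key' x hx y hy)

theorem mainTheorem6 (n : ℕ) (hn : 1 ≤ n) :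
    (∀ α : ℝ, 0 ≤ α → haloFunction (strongBasis n) α < ∞) ∧
      LocallyHolderOn (1 / (n : ℝ≥0)) (fun α => (haloFunction (strongBasis n) α).toReal)
        (Set.Ici 0) := by
  have hfin : ∀ α, haloFunction (strongBasis n) α ≠ ∞ := fun α =>
    (haloFunction_strongBasis_lt_top hn α).ne
  refine ⟨fun α _ => haloFunction_strongBasis_lt_top hn α, ?_⟩
  have hn1 : (1 : ℝ≥0) ≤ n := by exact_mod_cast hn
  -- `r` keeps 2 * 5^n * (y - x) within the admissible range (1/2)^n, and `c` absorbs the n-th root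
  -- of 2 * 5^n.
  refine locallyHolderOn_of_le_mul (c := 2 * 3 ^ n * (2 * 5 ^ n) ^ (1 / (n : ℝ)))
    (r := (1 / 2) ^ n / (2 * 5 ^ n)) ?_ ?_ ?_ (by positivity) (by positivity) ?_
  · exact fun α β h => ENNReal.toReal_mono (hfin β) (haloFunction_mono h)
  · intro x h0 h1
    simp only [haloFunction_of_le_one h1, ENNReal.toReal_ofReal h0]
  · exact div_le_one_of_le₀ hn1 zero_le
  · intro x y hx hxy hr
    have hd : 0 ≤ y - x := by linarith
    rw [le_div_iff₀' (by positivity)] at hr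
    have h := ENNReal.toReal_mono (ENNReal.mul_ne_top (hfin x) ENNReal.ofReal_ne_top)
      (haloFunction_le_mul_one_add hn hx hxy hr)
    rw [ENNReal.toReal_mul, ENNReal.toReal_ofReal (by positivity),
      Real.mul_rpow (by positivity) hd, ← mul_assoc] at h
    simpa only [NNReal.coe_div, NNReal.coe_one, NNReal.coe_natCast] using h
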